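/- Theorem. Let $d \ge 1$ be fixed. There is a constant $C$, depending only on $d$, such that for every $n \ge 0$ the following holds. Let $p_1, \ldots, p_n$ be random points picked uniformly and independently from $[0,1]^d$, and let $P = \{p_1, \ldots, p_n\}$. Let $\mathcal{D}(P)$ be the Delaunay triangulation of $P$, i.e. the simplicial complex whose simplices are the nonempty subsets $\sigma \subseteq P$ for which there is an open ball $B \subset \mathbb{R}^d$ (of positive radius) whose boundary sphere passes through all points of $\sigma$ and such that $B \cap P = \emptyset$. Then the complexity of $\mathcal{D}(P)$, i.e. the total number $|\mathcal{D}(P)|$ of its simplices of all dimensions, is an integrable random variable and $$ \mathbb{E}\bigl[\,|\mathcal{D}(P)|\,\bigr] \le C\, n . $$ In other words, the expected complexity of the Delaunay triangulation of $n$ uniform random points in $[0,1]^d$ is $O(n)$. -/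

import Mathlib

open MeasureTheory ProbabilityTheory

/-- The unit cube `[0,1]^d` in Euclidean space `ℝ^d`. -/
def unitCube (d : ℕ) : Set (EuclideanSpace ℝ (Fin d)) :=
  {x | ∀ i, x i ∈ Set.Icc (0 : ℝ) 1}

/-- The pencil of a set `S` of points of `ℝ^d`: the set of all open balls, of positive radius, whose
boundary sphere passes through all points of `S`. -/
def pencil {d : ℕ} (S : Set (EuclideanSpace ℝ (Fin d))) :
    Set (Set (EuclideanSpace ℝ (Fin d))) :=
  {B | ∃ (c : EuclideanSpace ℝ (Fin d)) (r : ℝ),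
    0 < r ∧ S ⊆ Metric.sphere c r ∧ B = Metric.ball c r}

/-- The Delaunay triangulation of a point set `P` in `ℝ^d`, as an abstract simplicial complex:
its simplices are the nonempty finite subsets `σ` of `P` for which some open ball whose boundary
sphere passes through all points of `σ` contains no point of `P`. -/
def delaunay {d : ℕ} (P : Set (EuclideanSpace ℝ (Fin d))) :
    PreAbstractSimplicialComplex (EuclideanSpace ℝ (Fin d)) where
  faces := {σ | σ.Nonempty ∧ (σ : Set (EuclideanSpace ℝ (Fin d))) ⊆ P ∧
    ∃ B ∈ pencil (σ : Set (EuclideanSpace ℝ (Fin d))), B ∩ P = ∅}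
  isRelLowerSet_faces := by
    rintro σ ⟨hne, hP, B, ⟨c, r, hr, hs, hB⟩, hdis⟩
    refine ⟨hne, fun τ hτσ hτ => ⟨hτ, ?_, B, ⟨c, r, hr, ?_, hB⟩, hdis⟩⟩
    · exact (Finset.coe_subset.2 hτσ).trans hP
    · exact (Finset.coe_subset.2 hτσ).trans hs

/-- A finite point set has finitely many Delaunay simplices. -/
theorem delaunay_faces_finite {d : ℕ} {P : Set (EuclideanSpace ℝ (Fin d))} (hP : P.Finite) :
    (delaunay P).faces.Finite :=
  (hP.finite_subsets.preimage Finset.coe_injective.injOn).subset fun _ hσ => hσ.2.1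

/-- The (combinatorial) complexity of the Delaunay triangulation of a finite point set `P`:
the number of its simplices, of all dimensions. -/
noncomputable def delaunayComplexity {d : ℕ} (P : Set (EuclideanSpace ℝ (Fin d))) : ℕ :=
  (delaunay P).faces.ncard

/-! Inside the cube every ball is, up to constants, an axis-parallel box. If `q` is the point of the
cube nearest to the centre `c`, then `|x - c|²` is, up to an additive constant, the separable sum of
`(x i - q i)² + w i * |x i - q i|` with `w i = 2 * |c i - q i|` (`dist_sq_eq_clamp`). So the
vertices of a simplex lie in a box around `q` with half sides `t i`, while a copy of that box shrunk
by a factor depending only on `d` is free of points (`exists_sizes`). Rounding to dyadic boxes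
leaves countably many pairs (`exists_boxes`).

There are few pairs of each shape. A coordinate in which `c` lies outside `[0,1]` has its own scale
but only two positions, as `q i` is 0 or 1; the remaining coordinates share one scale `2 ^ (-a)`. At
least one coordinate, so `e ≥ 1` of them, is always put in the second group, giving about `2 ^ (a *
e)` positions.

For a pair of volume about `v`, the probability that `k` given points fall into the large box and
the others avoid the small one, times `n ^ k`, is at most a constant times `profile (n * v)`
(`exists_binomial_bound`). As `k ≥ 2`, the profile is quadratic near 0, so the sum over `a`
converges and telescopes to a linear bound (`sum_range_profile_le`); the sum over the free scales is
geometric.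

Almost surely no `d + 2` of the points are cospherical (`ae_card_le_of_cospherical`), so only `2 ≤ k
≤ d + 1` occur besides the at most `n` vertices. -/

/-! ### Dyadic boxes and rounding. -/

/-- The product of dyadic cells of side lengths `2 ^ (-(s i + b))` and indices `m i`. -/
def smallBox {d : ℕ} (b : ℕ) (s m : Fin d → ℕ) : Set (EuclideanSpace ℝ (Fin d)) :=
  {x | ∀ i, x i ∈ Set.Icc ((m i : ℝ) / 2 ^ (s i + b)) ((m i + 1) / 2 ^ (s i + b))}

/-- The box of half side lengths `2 * 2 ^ (-s i)` around the lower corner of `smallBox b s m`. -/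
def largeBox {d : ℕ} (b : ℕ) (s m : Fin d → ℕ) : Set (EuclideanSpace ℝ (Fin d)) :=
  {x | ∀ i, x i ∈ Set.Icc ((m i : ℝ) / 2 ^ (s i + b) - 2 / 2 ^ s i)
    ((m i : ℝ) / 2 ^ (s i + b) + 2 / 2 ^ s i)}

/-- The scale vector that is free on `J` and constant outside `J`. -/
def scales {d : ℕ} (J : Finset (Fin d)) (α : J → ℕ) (a : ℕ) (i : Fin d) : ℕ :=
  if h : i ∈ J then α ⟨i, h⟩ else a

/-- The admissible cell indices: on `J` only the two extreme cells. -/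
def cells {d : ℕ} (b : ℕ) (J : Finset (Fin d)) (s : Fin d → ℕ) : Finset (Fin d → ℕ) :=
  Fintype.piFinset fun i =>
    if i ∈ J then {0, 2 ^ (s i + b) - 1} else Finset.range (2 ^ (s i + b))

theorem exists_dyadic_scale : ∃ f : ℝ → ℕ, ∀ t : ℝ, 0 < t → t ≤ 1 →
    1 / 2 ^ f t < 2 * t ∧ t ≤ 1 / 2 ^ f t := by
  have h : ∀ t : ℝ, ∃ a : ℕ, 0 < t → t ≤ 1 → 1 / 2 ^ a < 2 * t ∧ t ≤ 1 / 2 ^ a := by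
    intro t
    by_cases ht : 0 < t ∧ t ≤ 1
    · obtain ⟨a, h1, h2⟩ := exists_nat_pow_near_of_lt_one ht.1 ht.2
        (by norm_num : (0 : ℝ) < 1 / 2) (by norm_num)
      refine ⟨a, fun _ _ => ?_⟩
      rw [pow_succ] at h1
      rw [one_div_pow] at h1 h2
      exact ⟨by linarith, h2⟩
    · exact ⟨0, fun h0 h1 => absurd ⟨h0, h1⟩ ht⟩
  choose f hf using h
  exact ⟨f, hf⟩

theorem exists_dyadic_cell (N : ℕ) {c : ℝ} (h0 : 0 ≤ c) (h1 : c ≤ 1) :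
    ∃ m : ℕ, m < 2 ^ N ∧ (m : ℝ) / 2 ^ N ≤ c ∧ c ≤ (m + 1) / 2 ^ N ∧
      (c = 0 ∨ c = 1 → m = 0 ∨ m = 2 ^ N - 1) := by
  have hN : (0 : ℝ) < 2 ^ N := by positivity
  have hN1 : 1 ≤ 2 ^ N := Nat.one_le_two_pow
  -- At `c = 1` the floor would be `2 ^ N`, one past the last cell.
  rcases h1.eq_or_lt with rfl | h1
  · refine ⟨2 ^ N - 1, by omega, ?_, ?_, fun _ => Or.inr rfl⟩
    · rw [div_le_one hN]; push_cast [Nat.cast_sub hN1]; linarith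
    · rw [le_div_iff₀ hN]; push_cast [Nat.cast_sub hN1]; linarith
  · refine ⟨⌊c * 2 ^ N⌋₊, ?_, ?_, ?_, ?_⟩
    · rw [Nat.floor_lt (by positivity)]; push_cast; nlinarith
    · rw [div_le_iff₀ hN]; exact Nat.floor_le (by positivity)
    · rw [le_div_iff₀ hN]; exact (Nat.lt_floor_add_one _).le
    · rintro (rfl | rfl)
      · left; simp
      · exact absurd h1 (lt_irrefl _)

/-! ### The shape of a ball inside the cube. -/

/-- The nearest point of the unit interval. -/
noncomputable def clamp (c : ℝ) : ℝ := max 0 (min 1 c)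

theorem clamp_nonneg (c : ℝ) : 0 ≤ clamp c := le_max_left _ _

theorem clamp_le_one (c : ℝ) : clamp c ≤ 1 := max_le zero_le_one (min_le_left _ _)

theorem clamp_eq_of_ne {c : ℝ} (h : |c - clamp c| ≠ 0) : clamp c = 0 ∨ clamp c = 1 := by
  unfold clamp at *
  rcases le_total 1 c with h1 | h1
  · simp [h1]
  · rcases le_total 0 c with h0 | h0
    · simp [h1, h0] at h
    · simp [h0, h1]

/-- If `c` is outside the interval, `x` lies on the far side of `clamp c` from `c`, so the cross
term is nonnegative; otherwise `c = clamp c`. -/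
theorem sub_sq_eq_clamp {x c : ℝ} (h0 : 0 ≤ x) (h1 : x ≤ 1) :
    (x - c) ^ 2 = (x - clamp c) ^ 2 + 2 * |c - clamp c| * |x - clamp c| + |c - clamp c| ^ 2 := by
  rcases le_total 1 c with hc | hc
  · have : clamp c = 1 := by simp [clamp, hc]
    rw [this, abs_of_nonneg (by linarith), abs_of_nonpos (by linarith)]; ring
  · rcases le_total 0 c with hc0 | hc0
    · have : clamp c = c := by simp [clamp, hc, hc0]
      rw [this]; simp
    · have : clamp c = 0 := by simp [clamp, hc, hc0]
      rw [this, abs_of_nonpos (by linarith), abs_of_nonneg (by linarith)]; ring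

theorem dist_sq_eq_clamp {d : ℕ} {x c : EuclideanSpace ℝ (Fin d)} (hx : x ∈ unitCube d) :
    dist x c ^ 2 = ∑ i, ((x i - clamp (c i)) ^ 2 +
      2 * |c i - clamp (c i)| * |x i - clamp (c i)|) + ∑ i, |c i - clamp (c i)| ^ 2 := by
  rw [EuclideanSpace.dist_eq, Real.sq_sqrt (by positivity), ← Finset.sum_add_distrib]
  refine Finset.sum_congr rfl fun i _ => ?_
  rw [Real.dist_eq, sq_abs, sub_sq_eq_clamp (hx i).1 (hx i).2]

/-- A sphere through at least two points of the unit cube determines anisotropic sizes `t i` around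
the clamped centre, such that the points are at distance at most `t i` in each coordinate, and the
box shrunk by a constant factor lies in the ball. -/
theorem exists_sizes {d : ℕ} (hd : 1 ≤ d) {σ : Set (EuclideanSpace ℝ (Fin d))}
    (hQ : σ ⊆ unitCube d) (hσ : σ.Nontrivial) {c : EuclideanSpace ℝ (Fin d)} {r : ℝ} (hr : 0 < r)
    (hs : σ ⊆ Metric.sphere c r) :
    ∃ (t : Fin d → ℝ) (t₀ : ℝ), 0 < t₀ ∧ t₀ ≤ 1 ∧ (∀ i, 0 < t i) ∧ (∀ i, t i ≤ 1) ∧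
      (∀ i, |c i - clamp (c i)| = 0 → t i = t₀) ∧
      (∀ p ∈ σ, ∀ i, |p i - clamp (c i)| ≤ t i) ∧
      ∀ x ∈ unitCube d, (∀ i, 3 * d * |x i - clamp (c i)| ≤ t i) → x ∈ Metric.ball c r := by
  set w : Fin d → ℝ := fun i => 2 * |c i - clamp (c i)| with hw
  have hw0 : ∀ i, 0 ≤ w i := fun i => by positivity
  -- The level of the separable function that defines the sphere inside the cube.
  set R : ℝ := r ^ 2 - ∑ i, |c i - clamp (c i)| ^ 2 with hR
  have key : ∀ p ∈ σ, ∑ i, ((p i - clamp (c i)) ^ 2 + w i * |p i - clamp (c i)|) = R := by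
    intro p hp
    have h1 := dist_sq_eq_clamp (c := c) (hQ hp)
    rw [Metric.mem_sphere.1 (hs hp)] at h1
    rw [hR, h1]; ring
  have key' : ∀ p ∈ σ, ∀ i, (p i - clamp (c i)) ^ 2 + w i * |p i - clamp (c i)| ≤ R := by
    intro p hp i
    rw [← key p hp]
    exact Finset.single_le_sum
      (f := fun i => (p i - clamp (c i)) ^ 2 + w i * |p i - clamp (c i)|)
      (fun j _ => add_nonneg (sq_nonneg _) (mul_nonneg (hw0 j) (abs_nonneg _)))
      (Finset.mem_univ i)
  have hRpos : 0 < R := by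
    obtain ⟨p, hp, q, hq, hpq⟩ := hσ
    by_contra! hR0
    apply hpq
    ext i
    have hz : ∀ p ∈ σ, p i = clamp (c i) := by
      intro p hp
      have h1 := key' p hp i
      have h2 := mul_nonneg (hw0 i) (abs_nonneg (p i - clamp (c i)))
      have h3 : (p i - clamp (c i)) ^ 2 = 0 :=
        le_antisymm (by linarith) (sq_nonneg _)
      exact sub_eq_zero.1 (pow_eq_zero_iff (two_ne_zero) |>.1 h3)
    rw [hz p hp, hz q hq]
  have hρ : 0 < √R := Real.sqrt_pos.2 hRpos
  set t₀ := min 1 √R with ht₀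
  have ht₀p : 0 < t₀ := lt_min one_pos hρ
  -- The linear term imposes no restriction when `w i = 0`, whereas `R / 0` would be `0`.
  set t : Fin d → ℝ := fun i => if w i = 0 then t₀ else min t₀ (R / w i) with ht
  have htle : ∀ i, t i ≤ t₀ := fun i => by
    simp only [ht]; split_ifs
    · exact le_rfl
    · exact min_le_left _ _
  have htw : ∀ i, w i * t i ≤ R := fun i => by
    simp only [ht]; split_ifs with h
    · rw [h, zero_mul]; exact hRpos.le
    · have := (hw0 i).lt_of_ne' h
      calc w i * min t₀ (R / w i) ≤ w i * (R / w i) := by gcongr; exact min_le_right _ _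
        _ = R := by field_simp
  have htp : ∀ i, 0 < t i := fun i => by
    simp only [ht]; split_ifs with h
    · exact ht₀p
    · exact lt_min ht₀p (div_pos hRpos ((hw0 i).lt_of_ne' h))
  refine ⟨t, t₀, ht₀p, min_le_left _ _, htp, fun i => (htle i).trans (min_le_left _ _), ?_, ?_, ?_⟩
  · intro i hi
    have hwi : w i = 0 := by simp only [hw, hi, mul_zero]
    simp only [ht, hwi, if_true]
  · intro p hp i
    have h1 := key' p hp i
    have h0 : |p i - clamp (c i)| ≤ t₀ := by
      refine le_min ?_ ?_
      · have a1 := (hQ hp i).1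
        have a2 := (hQ hp i).2
        have a3 := clamp_nonneg (c i)
        have a4 := clamp_le_one (c i)
        rw [abs_le]; constructor <;> linarith
      · apply Real.abs_le_sqrt
        have := mul_nonneg (hw0 i) (abs_nonneg (p i - clamp (c i)))
        linarith
    simp only [ht]; split_ifs with h
    · exact h0
    · refine le_min h0 ?_
      rw [le_div_iff₀ ((hw0 i).lt_of_ne' h)]
      have := sq_nonneg (p i - clamp (c i))
      linarith
  · intro x hx hxt
    have hd0 : (1 : ℝ) ≤ d := by exact_mod_cast hd
    -- The factor `3 * d` makes the linear term at most `R / (3 * d)` and the square even smaller,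
    -- so the sum over `i` stays strictly below `R`.
    have hterm : ∀ i, (x i - clamp (c i)) ^ 2 + w i * |x i - clamp (c i)| ≤
        (2 * R / 3) / d := by
      intro i
      set u := |x i - clamp (c i)| with hu
      have hu0 : 0 ≤ u := abs_nonneg _
      have h1 := hxt i
      have h2 : t i ^ 2 ≤ R := by
        have : t i ≤ √R := (htle i).trans (min_le_right _ _)
        calc t i ^ 2 ≤ √R ^ 2 := by gcongr
          _ = R := Real.sq_sqrt hRpos.le
      rw [← sq_abs, ← hu, le_div_iff₀ (by linarith)]
      have h3 : w i * (3 * d * u) ≤ R := (mul_le_mul_of_nonneg_left h1 (hw0 i)).trans (htw i)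
      have h4 : (3 * d * u) ^ 2 ≤ R := le_trans (pow_le_pow_left₀ (by positivity) h1 2) h2
      have h5 : u ^ 2 * d ≤ u ^ 2 * d ^ 2 := by
        have : (d : ℝ) ≤ d ^ 2 := by nlinarith
        gcongr
      nlinarith
    have hsum := Finset.sum_le_sum fun i (_ : i ∈ Finset.univ) => hterm i
    rw [Finset.sum_const, Finset.card_univ, Fintype.card_fin, nsmul_eq_mul,
      mul_div_cancel₀ _ (by linarith)] at hsum
    have hdist := dist_sq_eq_clamp (c := c) hx
    rw [Metric.mem_ball]
    refine lt_of_pow_lt_pow_left₀ 2 hr.le ?_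
    rw [hdist]
    linarith

/-- Each `t i` is rounded up to a power of two and the clamped centre is replaced by the corner of a
cell containing it. The cells are finer than the scale by `2 ^ (d + 3)`, so they fit in the shrunken
box. -/
theorem exists_boxes {d : ℕ} (hd : 1 ≤ d) {σ : Set (EuclideanSpace ℝ (Fin d))}
    (hQ : σ ⊆ unitCube d) (hσ : σ.Nontrivial) {c : EuclideanSpace ℝ (Fin d)} {r : ℝ} (hr : 0 < r)
    (hs : σ ⊆ Metric.sphere c r) :
    ∃ J : Finset (Fin d), J ≠ Finset.univ ∧ ∃ (α : J → ℕ) (a : ℕ),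
      ∃ m ∈ cells (d + 3) J (scales J α a), σ ⊆ largeBox (d + 3) (scales J α a) m ∧
        smallBox (d + 3) (scales J α a) m ∩ unitCube d ⊆ Metric.ball c r := by
  obtain ⟨t, t₀, ht₀, ht₀1, htp, ht1, htt, hbig, hsmall⟩ := exists_sizes hd hQ hσ hr hs
  obtain ⟨f, hf⟩ := exists_dyadic_scale
  -- `J` collects the coordinates where the centre is outside the interval. If these are all,
  -- coordinate 0 is removed and its scale serves as `a`.
  obtain ⟨J, hJ, a, hJa, hJc⟩ : ∃ J : Finset (Fin d), J ≠ Finset.univ ∧ ∃ a : ℕ,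
      (∀ i ∉ J, f (t i) = a) ∧ ∀ i ∈ J, clamp (c i) = 0 ∨ clamp (c i) = 1 := by
    by_cases h : ∃ i, |c i - clamp (c i)| = 0
    · obtain ⟨i₀, hi₀⟩ := h
      refine ⟨Finset.univ.filter fun i => |c i - clamp (c i)| ≠ 0, ?_, f t₀, ?_, ?_⟩
      · intro hu
        have := hu ▸ Finset.mem_univ i₀
        simp only [Finset.mem_filter] at this
        exact this.2 hi₀
      · intro i hi
        rw [htt i (by simpa using hi)]
      · intro i hi
        exact clamp_eq_of_ne (Finset.mem_filter.1 hi).2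
    · push Not at h
      refine ⟨Finset.univ.erase ⟨0, hd⟩, ?_, f (t ⟨0, hd⟩), ?_, ?_⟩
      · intro hu
        have := hu ▸ Finset.mem_univ (⟨0, hd⟩ : Fin d)
        simp at this
      · intro i hi
        simp only [Finset.mem_erase, Finset.mem_univ, and_true, not_not] at hi
        rw [hi]
      · intro i _
        exact clamp_eq_of_ne (h i)
  have hsc : scales J (fun i => f (t i)) a = fun i => f (t i) := by
    funext i
    unfold scales
    split_ifs with h
    · rfl
    · exact (hJa i h).symm
  have hcell := fun i => exists_dyadic_cell (f (t i) + (d + 3)) (clamp_nonneg (c i))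
    (clamp_le_one (c i))
  choose m hm1 hm2 hm3 hm4 using hcell
  have hpow : ∀ i, (1 : ℝ) / 2 ^ (f (t i) + (d + 3)) * (3 * d) ≤ t i := by
    intro i
    have h1 := (hf (t i) (htp i) (ht1 i)).1
    have h2 : (d : ℝ) ≤ 2 ^ d := by exact_mod_cast d.lt_two_pow_self.le
    have h3 : (1 : ℝ) / 2 ^ (f (t i) + (d + 3)) * (3 * d) =
        (1 / 2 ^ f (t i)) * ((3 * d) / (8 * 2 ^ d)) := by
      rw [pow_add, pow_add]; field_simp; norm_num
    have h4 : (3 * (d : ℝ)) / (8 * 2 ^ d) ≤ 1 / 2 := by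
      rw [div_le_div_iff₀ (by positivity) (by norm_num)]
      linarith
    rw [h3]
    calc (1 / 2 ^ f (t i)) * ((3 * (d : ℝ)) / (8 * 2 ^ d)) ≤ (2 * t i) * (1 / 2) := by
          have := (htp i).le
          gcongr
      _ = t i := by ring
  refine ⟨J, hJ, fun i => f (t i), a, m, ?_, ?_, ?_⟩
  · rw [hsc, cells, Fintype.mem_piFinset]
    intro i
    split_ifs with h
    · simpa using hm4 i (hJc i h)
    · simpa using hm1 i
  · intro p hp i
    rw [hsc]
    have h1 := abs_le.1 (hbig p hp i)
    have h2 := (hf (t i) (htp i) (ht1 i)).2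
    have h3 := hm2 i
    have h4 := hm3 i
    have h5 : (1 : ℝ) / 2 ^ (f (t i) + (d + 3)) ≤ 1 / 2 ^ f (t i) := by
      gcongr <;> simp
    -- One half pays for the distance to the clamped centre, the other for the distance from there
    -- to the cell corner.
    have h6 : (2 : ℝ) / 2 ^ f (t i) = 1 / 2 ^ f (t i) + 1 / 2 ^ f (t i) := by ring
    rw [add_div] at h4
    simp only [Set.mem_Icc]
    rw [h6]
    constructor <;> linarith [h1.1, h1.2]
  · rintro x ⟨hx, hxQ⟩
    refine hsmall x hxQ fun i => ?_
    rw [hsc] at hx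
    have hxi := hx i
    simp only [Set.mem_Icc] at hxi
    have h3 := hm2 i
    have h4 := hm3 i
    rw [add_div] at h4 hxi
    have h5 : |x i - clamp (c i)| ≤ 1 / 2 ^ (f (t i) + (d + 3)) := by
      rw [abs_le]; constructor <;> linarith [hxi.1, hxi.2]
    refine le_trans ?_ (hpow i)
    rw [mul_comm]
    gcongr

/-! ### The profile and its sum over all scales. -/

/-- The profile bounding the expected number of simplices in a box with `y` expected points. -/
noncomputable def profile (y : ℝ) : ℝ := y ^ 2 / ((1 + y) * (2 + y))

theorem profile_nonneg {y : ℝ} (hy : 0 ≤ y) : 0 ≤ profile y := by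
  unfold profile; positivity

/-- The difference of `y / (1 + y)` at `y` and `y / 2` is what telescopes over dyadic scales. -/
theorem profile_eq {y : ℝ} (hy : 0 ≤ y) :
    profile y = y * (y / (1 + y) - (y / 2) / (1 + y / 2)) := by
  unfold profile; field_simp; ring

/-- The exponential beats the power. Passing to `2 + y ≥ 1` lets the single exponent `D` serve every
`k ≤ D`; `k ≥ 2` supplies the factor `y ^ 2`. -/
theorem pow_mul_exp_neg_le_profile (D : ℕ) {c y : ℝ} (hc : 0 < c) (hc1 : c ≤ 1) (hy : 0 ≤ y)
    {k : ℕ} (hk : 2 ≤ k) (hkD : k ≤ D) :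
    y ^ k * Real.exp (-(c * y)) ≤ Real.exp 2 * D.factorial / c ^ D * profile y := by
  have h1 : (2 + y) ^ D * Real.exp (-(c * (2 + y))) ≤ D.factorial / c ^ D := by
    have := Real.pow_div_factorial_le_exp (c * (2 + y)) (by positivity) D
    rw [Real.exp_neg, ← div_eq_mul_inv, div_le_div_iff₀ (by positivity) (by positivity)]
    rw [div_le_iff₀ (by positivity), mul_pow] at this
    linarith
  have h2 : Real.exp (-(c * y)) ≤ Real.exp 2 * Real.exp (-(c * (2 + y))) := by
    rw [← Real.exp_add]
    apply Real.exp_le_exp.2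
    linarith
  have h3 : y ^ (k - 2) * ((1 + y) * (2 + y)) ≤ (2 + y) ^ D := by
    calc y ^ (k - 2) * ((1 + y) * (2 + y)) ≤ (2 + y) ^ (k - 2) * ((2 + y) * (2 + y)) := by
          gcongr <;> linarith
      _ = (2 + y) ^ k := by
          rw [← pow_two, ← pow_add, Nat.sub_add_cancel hk]
      _ ≤ (2 + y) ^ D := by gcongr; linarith
  have h4 : y ^ k = y ^ (k - 2) * ((1 + y) * (2 + y)) * profile y := by
    unfold profile
    rw [← Nat.sub_add_cancel hk, pow_add]
    simp only [Nat.add_sub_cancel]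
    field_simp
  have hp := profile_nonneg hy
  calc y ^ k * Real.exp (-(c * y))
      ≤ ((2 + y) ^ D * profile y) * (Real.exp 2 * Real.exp (-(c * (2 + y)))) := by
        rw [h4]; gcongr
    _ = Real.exp 2 * profile y * ((2 + y) ^ D * Real.exp (-(c * (2 + y)))) := by ring
    _ ≤ Real.exp 2 * profile y * (D.factorial / c ^ D) := by gcongr
    _ = _ := by ring

/-- The binomial-type bound: `k` prescribed points fall into a box of volume `L * v`, while the
other `n - k` points avoid a box of volume `c * v`. -/
theorem exists_binomial_bound (D : ℕ) {c L : ℝ} (hc : 0 < c) (hc1 : c ≤ 1) (hL : 1 ≤ L) :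
    ∃ K : ℝ, 0 ≤ K ∧ ∀ (n k : ℕ) (v : ℝ), 2 ≤ k → k ≤ D → k ≤ n → 0 ≤ v → v ≤ 1 →
      (n : ℝ) ^ k * ((L * v) ^ k * (1 - c * v) ^ (n - k)) ≤ K * profile (n * v) := by
  refine ⟨L ^ D * Real.exp D * (Real.exp 2 * D.factorial / c ^ D), by positivity, ?_⟩
  intro n k v hk hkD hkn hv hv1
  have hcv : c * v ≤ 1 := by nlinarith
  -- Replacing `n - k` by `n` in the exponent costs at most `exp D`, since `k * c * v ≤ D`.
  have hexp : (1 - c * v) ^ (n - k) ≤ Real.exp D * Real.exp (-(c * (n * v))) := by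
    calc (1 - c * v) ^ (n - k) ≤ Real.exp (-(c * v)) ^ (n - k) := by
          exact pow_le_pow_left₀ (by linarith) (Real.one_sub_le_exp_neg _) _
      _ = Real.exp (k * (c * v) - c * (n * v)) := by
          rw [← Real.exp_nat_mul, Nat.cast_sub hkn]; ring_nf
      _ ≤ Real.exp (D + -(c * (n * v))) := by
          apply Real.exp_le_exp.2
          have : (k : ℝ) * (c * v) ≤ D * 1 := by gcongr
          linarith
      _ = _ := Real.exp_add _ _
  have hLk : L ^ k ≤ L ^ D := pow_le_pow_right₀ hL hkD
  calc (n : ℝ) ^ k * ((L * v) ^ k * (1 - c * v) ^ (n - k))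
      = L ^ k * ((n * v) ^ k * (1 - c * v) ^ (n - k)) := by rw [mul_pow, mul_pow]; ring
    _ ≤ L ^ D * ((n * v) ^ k * (Real.exp D * Real.exp (-(c * (n * v))))) := by
        have : 0 ≤ 1 - c * v := by linarith
        gcongr
    _ = L ^ D * Real.exp D * ((n * v) ^ k * Real.exp (-(c * (n * v)))) := by ring
    _ ≤ L ^ D * Real.exp D * (Real.exp 2 * D.factorial / c ^ D * profile (n * v)) := by
        exact mul_le_mul_of_nonneg_left
          (pow_mul_exp_neg_le_profile D hc hc1 (by positivity) hk hkD) (by positivity)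
    _ = _ := by ring

/-- By `profile_eq` and monotonicity of `g`, each term is at most `A` times a difference of
consecutive values of `g`; `e ≥ 1` makes the argument at least halve at each step. -/
theorem sum_range_profile_le {A : ℝ} (hA : 0 ≤ A) {e : ℕ} (he : 1 ≤ e) (N : ℕ) :
    ∑ a ∈ Finset.range N, 2 ^ (a * e) * profile (A / 2 ^ (a * e)) ≤ A := by
  set g : ℝ → ℝ := fun y => y / (1 + y) with hg
  have hterm : ∀ a ∈ Finset.range N, (2 : ℝ) ^ (a * e) * profile (A / 2 ^ (a * e)) ≤
      A * (g (A / 2 ^ (a * e)) - g (A / 2 ^ ((a + 1) * e))) := by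
    intro a _
    have hy : 0 ≤ A / 2 ^ (a * e) := by positivity
    have h2 : A / 2 ^ ((a + 1) * e) ≤ A / 2 ^ (a * e) / 2 := by
      rw [div_div, add_mul, one_mul, pow_add]
      gcongr
      calc (2 : ℝ) = 2 ^ 1 := by norm_num
        _ ≤ 2 ^ e := by gcongr; norm_num
    have h3 : g (A / 2 ^ ((a + 1) * e)) ≤ g (A / 2 ^ (a * e) / 2) := by
      have h0 : 0 ≤ A / 2 ^ ((a + 1) * e) := by positivity
      simp only [hg]
      rw [div_le_div_iff₀ (by positivity) (by positivity)]
      nlinarith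
    rw [profile_eq hy, ← mul_assoc, mul_div_cancel₀ _ (by positivity)]
    gcongr
  refine (Finset.sum_le_sum hterm).trans ?_
  rw [← Finset.mul_sum, Finset.sum_range_sub']
  have h0 : g (A / 2 ^ (0 * e)) ≤ 1 := by
    simp only [hg]
    rw [div_le_one (by positivity)]; linarith
  have hN : 0 ≤ g (A / 2 ^ (N * e)) := by simp only [hg]; positivity
  calc A * (g (A / 2 ^ (0 * e)) - g (A / 2 ^ (N * e))) ≤ A * 1 := by gcongr; linarith
    _ = A := mul_one A

theorem tsum_pi_geometric_le (ι : Type*) [Fintype ι] [DecidableEq ι] :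
    ∑' α : ι → ℕ, ENNReal.ofReal (∏ i, 1 / 2 ^ α i) ≤ ENNReal.ofReal (2 ^ Fintype.card ι) := by
  rw [ENNReal.tsum_eq_iSup_sum]
  refine iSup_le fun s => ?_
  rw [← ENNReal.ofReal_sum_of_nonneg fun _ _ => by positivity]
  apply ENNReal.ofReal_le_ofReal
  obtain ⟨N, hN⟩ : ∃ N, ∀ α ∈ s, ∀ i, α i < N := by
    refine ⟨s.sup (fun α => Finset.univ.sup α) + 1, fun α hα i => Nat.lt_succ_of_le ?_⟩
    exact (Finset.le_sup (f := α) (Finset.mem_univ i)).trans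
      (Finset.le_sup (f := fun α : ι → ℕ => Finset.univ.sup α) hα)
  calc ∑ α ∈ s, ∏ i, (1 : ℝ) / 2 ^ α i
      ≤ ∑ α ∈ Fintype.piFinset fun _ : ι => Finset.range N, ∏ i, (1 : ℝ) / 2 ^ α i := by
        refine Finset.sum_le_sum_of_subset_of_nonneg ?_ fun _ _ _ => by positivity
        intro α hα
        simpa using hN α hα
    _ = ∏ _i : ι, ∑ j ∈ Finset.range N, (1 : ℝ) / 2 ^ j :=
        (Finset.prod_univ_sum (fun _ => Finset.range N) fun _ j => (1 : ℝ) / 2 ^ j).symm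
    _ ≤ ∏ _i : ι, (2 : ℝ) := by
        refine Finset.prod_le_prod (fun _ _ => by positivity) fun _ _ => ?_
        simpa using sum_geometric_two_le N
    _ = 2 ^ Fintype.card ι := by simp

theorem prod_scales {d : ℕ} (J : Finset (Fin d)) (α : J → ℕ) (a : ℕ) :
    ∏ i, (1 : ℝ) / 2 ^ scales J α a i = (∏ i, 1 / 2 ^ α i) / 2 ^ (a * (d - J.card)) := by
  have hs : ∀ i, (1 : ℝ) / 2 ^ scales J α a i =
      if h : i ∈ J then 1 / 2 ^ α ⟨i, h⟩ else 1 / 2 ^ a := by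
    intro i; unfold scales; split_ifs <;> rfl
  simp_rw [hs]
  rw [Finset.prod_dite]
  have h1 : ∏ x : {x // x ∈ Finset.univ.filter (· ∈ J)},
      (1 : ℝ) / 2 ^ α ⟨x.1, (Finset.mem_filter.1 x.2).2⟩ = ∏ i : J, 1 / 2 ^ α i := by
    refine Fintype.prod_equiv (Equiv.subtypeEquivRight fun x => by simp) _ _ fun x => rfl
  rw [Finset.univ_eq_attach] at h1
  simp only [Finset.univ_eq_attach] at h1 ⊢
  rw [h1, Finset.prod_const, Finset.card_attach, div_eq_mul_inv _ (2 ^ _)]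
  congr 1
  have : (Finset.univ.filter fun x => x ∉ J).card = d - J.card := by
    rw [← Finset.compl_filter, Finset.card_compl]; simp
  rw [this, one_mul, inv_pow, ← pow_mul]

theorem card_cells_le {d b : ℕ} (J : Finset (Fin d)) (α : J → ℕ) (a : ℕ) :
    (cells b J (scales J α a)).card ≤ 2 ^ d * 2 ^ (b * d) * 2 ^ (a * (d - J.card)) := by
  rw [cells, Fintype.card_piFinset]
  calc ∏ i, (if i ∈ J then ({0, 2 ^ (scales J α a i + b) - 1} : Finset ℕ)
          else Finset.range (2 ^ (scales J α a i + b))).card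
      ≤ ∏ i, (if i ∈ J then 2 * 2 ^ b * 1 else 2 * 2 ^ b * 2 ^ a) := by
        refine Finset.prod_le_prod' fun i _ => ?_
        split_ifs with h
        · refine Finset.card_le_two.trans ?_
          have : 1 ≤ 2 ^ b := Nat.one_le_two_pow
          omega
        · rw [Finset.card_range, scales, dif_neg h, pow_add]
          have : 0 < 2 ^ a * 2 ^ b := by positivity
          nlinarith
    _ = ∏ i, (2 * 2 ^ b * if i ∈ J then 1 else 2 ^ a) := by
        refine Finset.prod_congr rfl fun i _ => ?_
        split_ifs <;> rfl
    _ = 2 ^ d * 2 ^ (b * d) * 2 ^ (a * (d - J.card)) := by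
        have : (Finset.univ.filter fun x => x ∉ J).card = d - J.card := by
          rw [← Finset.compl_filter, Finset.card_compl]; simp
        rw [Finset.prod_mul_distrib, Finset.prod_ite, Finset.prod_const, Finset.prod_const,
          Finset.prod_const, this, one_pow, one_mul, Finset.card_univ, Fintype.card_fin,
          mul_pow, ← pow_mul, ← pow_mul]

/-- For fixed `α` the cell count cancels the shrinking of the volume in `a`, so the sum over `a` is
linear in `n * ∏ i, 1 / 2 ^ α i`; what remains is a product of geometric series. -/
theorem tsum_profile_le {d b : ℕ} {J : Finset (Fin d)} (hJ : J ≠ Finset.univ) (n : ℕ) :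
    ∑' (α : J → ℕ) (a : ℕ), ∑ _m ∈ cells b J (scales J α a),
      ENNReal.ofReal (profile (n * ∏ i, 1 / 2 ^ scales J α a i)) ≤
    ENNReal.ofReal (2 ^ d * 2 ^ (b * d) * 2 ^ d * n) := by
  have he : 1 ≤ d - J.card := by
    have := Finset.card_lt_card (Finset.ssubset_univ_iff.2 hJ)
    rw [Finset.card_univ, Fintype.card_fin] at this
    omega
  have hinner : ∀ α : J → ℕ, ∑' a : ℕ, ∑ _m ∈ cells b J (scales J α a),
      ENNReal.ofReal (profile (n * ∏ i, 1 / 2 ^ scales J α a i)) ≤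
      ENNReal.ofReal (2 ^ d * 2 ^ (b * d) * n) * ENNReal.ofReal (∏ i, 1 / 2 ^ α i) := by
    intro α
    set A : ℝ := n * ∏ i, 1 / 2 ^ α i with hA
    have hA0 : 0 ≤ A := by positivity
    refine ENNReal.tsum_le_of_sum_range_le fun N => ?_
    rw [← ENNReal.ofReal_mul (by positivity), mul_assoc, ← hA]
    calc ∑ a ∈ Finset.range N, ∑ _m ∈ cells b J (scales J α a),
          ENNReal.ofReal (profile (n * ∏ i, 1 / 2 ^ scales J α a i))
        ≤ ∑ a ∈ Finset.range N, ENNReal.ofReal (2 ^ d * 2 ^ (b * d) *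
            (2 ^ (a * (d - J.card)) * profile (A / 2 ^ (a * (d - J.card))))) := by
          refine Finset.sum_le_sum fun a _ => ?_
          rw [Finset.sum_const, prod_scales, ← mul_div_assoc, ← hA, nsmul_eq_mul,
            ← ENNReal.ofReal_natCast, ← ENNReal.ofReal_mul (by positivity)]
          apply ENNReal.ofReal_le_ofReal
          rw [← mul_assoc]
          refine mul_le_mul_of_nonneg_right ?_ (profile_nonneg (by positivity))
          exact_mod_cast card_cells_le J α a
      _ = ENNReal.ofReal (2 ^ d * 2 ^ (b * d) * ∑ a ∈ Finset.range N,
            2 ^ (a * (d - J.card)) * profile (A / 2 ^ (a * (d - J.card)))) := by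
          rw [Finset.mul_sum, ENNReal.ofReal_sum_of_nonneg]
          intro a _
          have := profile_nonneg (y := A / 2 ^ (a * (d - J.card))) (by positivity)
          positivity
      _ ≤ ENNReal.ofReal (2 ^ d * 2 ^ (b * d) * A) := by
          apply ENNReal.ofReal_le_ofReal
          gcongr
          exact sum_range_profile_le hA0 he N
  calc _ ≤ ∑' α : J → ℕ, ENNReal.ofReal (2 ^ d * 2 ^ (b * d) * n) *
          ENNReal.ofReal (∏ i, 1 / 2 ^ α i) := ENNReal.tsum_le_tsum hinner
    _ ≤ ENNReal.ofReal (2 ^ d * 2 ^ (b * d) * n) * ENNReal.ofReal (2 ^ d) := by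
        rw [ENNReal.tsum_mul_left]
        gcongr
        refine (tsum_pi_geometric_le J).trans (ENNReal.ofReal_le_ofReal ?_)
        gcongr
        · norm_num
        · simpa using Finset.card_le_univ J
    _ = _ := by
        rw [← ENNReal.ofReal_mul (by positivity)]
        congr 1; ring

/-! ### Volumes of boxes and the probability of a box event. -/

theorem volume_box {d : ℕ} (l u : Fin d → ℝ) :
    volume {x : EuclideanSpace ℝ (Fin d) | ∀ i, x i ∈ Set.Icc (l i) (u i)} =
      ∏ i, ENNReal.ofReal (u i - l i) := by
  have h := (EuclideanSpace.volume_preserving_symm_measurableEquiv_toLp (Fin d)).measure_preimage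
    (measurableSet_Icc (a := l) (b := u)).nullMeasurableSet
  rw [Real.volume_Icc_pi] at h
  rw [← h]
  congr 1
  ext x
  simp [Set.mem_Icc, Pi.le_def, forall_and]

theorem measurableSet_box {d : ℕ} (l u : Fin d → ℝ) :
    MeasurableSet {x : EuclideanSpace ℝ (Fin d) | ∀ i, x i ∈ Set.Icc (l i) (u i)} := by
  rw [Set.ofPred_forall]
  exact MeasurableSet.iInter fun i => measurableSet_Icc.preimage (by fun_prop)

theorem measurableSet_smallBox {d : ℕ} (b : ℕ) (s m : Fin d → ℕ) :
    MeasurableSet (smallBox b s m) := measurableSet_box _ _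

theorem measurableSet_largeBox {d : ℕ} (b : ℕ) (s m : Fin d → ℕ) :
    MeasurableSet (largeBox b s m) := measurableSet_box _ _

theorem volume_unitCube (d : ℕ) : volume (unitCube d) = 1 := by
  rw [unitCube, volume_box]; simp

theorem volume_largeBox {d : ℕ} (b : ℕ) (s m : Fin d → ℕ) :
    volume (largeBox b s m) = ENNReal.ofReal (4 ^ d * ∏ i, 1 / 2 ^ s i) := by
  rw [largeBox, volume_box, ← ENNReal.ofReal_prod_of_nonneg]
  · congr 1
    have : (4 : ℝ) ^ d = ∏ _i : Fin d, (4 : ℝ) := by simp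
    rw [this, ← Finset.prod_mul_distrib]
    refine Finset.prod_congr rfl fun i _ => ?_
    ring
  · intro i _
    rw [add_sub_sub_cancel]; positivity

theorem volume_smallBox {d : ℕ} (b : ℕ) (s m : Fin d → ℕ) :
    volume (smallBox b s m) = ENNReal.ofReal (1 / 2 ^ (b * d) * ∏ i, 1 / 2 ^ s i) := by
  rw [smallBox, volume_box, ← ENNReal.ofReal_prod_of_nonneg]
  · congr 1
    have : (1 : ℝ) / 2 ^ (b * d) = ∏ _i : Fin d, (1 : ℝ) / 2 ^ b := by
      simp [pow_mul]
    rw [this, ← Finset.prod_mul_distrib]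
    refine Finset.prod_congr rfl fun i _ => ?_
    rw [← sub_div, add_sub_cancel_left, pow_add]; field_simp
  · intro i _
    rw [← sub_div, add_sub_cancel_left]; positivity

theorem smallBox_subset_unitCube {d b : ℕ} {J : Finset (Fin d)} {s m : Fin d → ℕ}
    (hm : m ∈ cells b J s) : smallBox b s m ⊆ unitCube d := by
  intro x hx i
  have h := hx i
  have hmi : m i + 1 ≤ 2 ^ (s i + b) := by
    have h1 := Fintype.mem_piFinset.1 hm i
    have h2 : 0 < 2 ^ (s i + b) := by positivity
    split_ifs at h1
    · simp only [Finset.mem_insert, Finset.mem_singleton] at h1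
      omega
    · simp only [Finset.mem_range] at h1
      omega
  refine ⟨le_trans (by positivity) h.1, h.2.trans ?_⟩
  rw [div_le_one (by positivity)]
  exact_mod_cast hmi

/-- Independence factors the event. The large box may leave the cube, which only helps; the small
one lies inside it, so its volume is exactly the hitting probability. -/
theorem measure_boxes_le {d n b : ℕ} {Ω : Type*} [MeasurableSpace Ω] {μ : Measure Ω}
    [IsProbabilityMeasure μ] {X : Fin n → Ω → EuclideanSpace ℝ (Fin d)}
    (hX : ∀ i, Measurable (X i)) (hind : iIndepFun X μ)
    (hu : ∀ i, pdf.IsUniform (X i) (unitCube d) μ volume) (I : Finset (Fin n))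
    {J : Finset (Fin d)} {s m : Fin d → ℕ} (hm : m ∈ cells b J s) :
    μ {ω | (∀ i ∈ I, X i ω ∈ largeBox b s m) ∧ ∀ i ∉ I, X i ω ∉ smallBox b s m} ≤
      ENNReal.ofReal ((4 ^ d * ∏ i, 1 / 2 ^ s i) ^ I.card *
        (1 - 1 / 2 ^ (b * d) * ∏ i, 1 / 2 ^ s i) ^ (n - I.card)) := by
  set v : ℝ := ∏ i, 1 / 2 ^ s i with hv
  have hv0 : 0 ≤ v := by positivity
  have hv1 : v ≤ 1 := Finset.prod_le_one (fun _ _ => by positivity) fun i _ => by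
    rw [div_le_one (by positivity)]; exact one_le_pow₀ (by norm_num)
  have hc1 : (1 : ℝ) / 2 ^ (b * d) * v ≤ 1 := by
    refine mul_le_one₀ ?_ hv0 hv1
    rw [div_le_one (by positivity)]; exact one_le_pow₀ (by norm_num)
  have hQ0 : volume (unitCube d) ≠ 0 := by rw [volume_unitCube]; exact one_ne_zero
  have hQt : volume (unitCube d) ≠ ⊤ := by rw [volume_unitCube]; exact ENNReal.one_ne_top
  have hpre : ∀ i {A : Set (EuclideanSpace ℝ (Fin d))}, MeasurableSet A →
      μ (X i ⁻¹' A) = volume (unitCube d ∩ A) := fun i A hA => by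
    rw [(hu i).measure_preimage hQ0 hQt hA, volume_unitCube, div_one]
  set A : Fin n → Set (EuclideanSpace ℝ (Fin d)) := fun i =>
    if i ∈ I then largeBox b s m else (smallBox b s m)ᶜ with hA
  have hAm : ∀ i, MeasurableSet (A i) := fun i => by
    simp only [hA]; split_ifs
    · exact measurableSet_largeBox _ _ _
    · exact (measurableSet_smallBox _ _ _).compl
  have hset : {ω | (∀ i ∈ I, X i ω ∈ largeBox b s m) ∧ ∀ i ∉ I, X i ω ∉ smallBox b s m} ⊆
      ⋂ i ∈ Finset.univ, X i ⁻¹' A i := by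
    rintro ω ⟨h1, h2⟩
    simp only [Set.mem_iInter, Set.mem_preimage, hA]
    intro i _
    split_ifs with h
    · exact h1 i h
    · exact h2 i h
  refine (measure_mono hset).trans ?_
  rw [hind.measure_inter_preimage_eq_mul Finset.univ fun i _ => hAm i]
  have hfac : ∀ i, μ (X i ⁻¹' A i) ≤
      if i ∈ I then ENNReal.ofReal (4 ^ d * v) else ENNReal.ofReal (1 - 1 / 2 ^ (b * d) * v) := by
    intro i
    simp only [hA]
    split_ifs with h
    · rw [hpre i (measurableSet_largeBox _ _ _), ← volume_largeBox b s m]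
      exact measure_mono Set.inter_subset_right
    · rw [Set.preimage_compl, prob_compl_eq_one_sub ((measurableSet_smallBox _ _ _).preimage (hX i)),
        hpre i (measurableSet_smallBox _ _ _),
        Set.inter_eq_right.2 (smallBox_subset_unitCube hm), volume_smallBox,
        ENNReal.ofReal_sub _ (by positivity), ENNReal.ofReal_one]
  refine (Finset.prod_le_prod' fun i _ => hfac i).trans ?_
  have hcard : (Finset.univ.filter fun x => x ∉ I).card = n - I.card := by
    rw [← Finset.compl_filter, Finset.card_compl]; simp
  rw [Finset.prod_ite, Finset.prod_const, Finset.prod_const, hcard, Finset.filter_mem_eq_inter,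
    Finset.univ_inter, ← ENNReal.ofReal_pow (by positivity), ← ENNReal.ofReal_pow (by linarith),
    ← ENNReal.ofReal_mul (by positivity)]

/-! ### Simplices as index sets, and measurability. -/

/-- Some ball that contains none of the points `x j` has all `x i`, `i ∈ I`, on its boundary. -/
def IsDelaunay {d n : ℕ} (I : Finset (Fin n)) (x : Fin n → EuclideanSpace ℝ (Fin d)) : Prop :=
  ∃ (c : EuclideanSpace ℝ (Fin d)) (r : ℝ), 0 < r ∧ (∀ i ∈ I, dist (x i) c = r) ∧
    ∀ j, r ≤ dist (x j) c

/-- Every index in `I` is the least one of its point. -/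
def IsMinimalRep {d n : ℕ} (I : Finset (Fin n)) (x : Fin n → EuclideanSpace ℝ (Fin d)) : Prop :=
  ∀ i ∈ I, ∀ j, x j = x i → i ≤ j

theorem IsMinimalRep.injOn {d n : ℕ} {I : Finset (Fin n)} {x : Fin n → EuclideanSpace ℝ (Fin d)}
    (h : IsMinimalRep I x) : Set.InjOn x I := fun i hi j hj hij =>
  le_antisymm (h i hi j hij.symm) (h j hj i hij)

-- Points may coincide, so a simplex can come from several index sets; taking least indices selects
-- exactly one.
open Classical in
theorem delaunayComplexity_eq_card {d n : ℕ} (x : Fin n → EuclideanSpace ℝ (Fin d)) :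
    delaunayComplexity (Set.range x) = (Finset.univ.filter fun I : Finset (Fin n) =>
      I.Nonempty ∧ IsMinimalRep I x ∧ IsDelaunay I x).card := by
  set F := Finset.univ.filter fun I : Finset (Fin n) =>
      I.Nonempty ∧ IsMinimalRep I x ∧ IsDelaunay I x with hF
  have himg : (delaunay (Set.range x)).faces = (fun I : Finset (Fin n) => I.image x) '' F := by
    ext σ
    simp only [hF, Finset.coe_filter, Finset.mem_univ, true_and, Set.mem_image, Set.mem_ofPred_eq]
    constructor
    · rintro ⟨hne, hsub, B, ⟨c, r, hr, hs, rfl⟩, hB⟩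
      set I := Finset.univ.filter fun i => x i ∈ σ ∧ ∀ j, x j = x i → i ≤ j with hI
      have hIσ : I.image x = σ := by
        ext p
        simp only [hI, Finset.mem_image, Finset.mem_filter, Finset.mem_univ, true_and]
        constructor
        · rintro ⟨i, ⟨hi, -⟩, rfl⟩; exact hi
        · intro hp
          obtain ⟨k, rfl⟩ := hsub hp
          have hne : (Finset.univ.filter fun j => x j = x k).Nonempty := ⟨k, by simp⟩
          have hmem := Finset.min'_mem _ hne
          simp only [Finset.mem_filter, Finset.mem_univ, true_and] at hmem
          refine ⟨_, ⟨by rwa [hmem], fun j hj => ?_⟩, hmem⟩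
          exact Finset.min'_le _ _ (by simp [hj, hmem])
      refine ⟨I, ⟨?_, ?_, c, r, hr, ?_, ?_⟩, hIσ⟩
      · rw [← hIσ] at hne
        exact Finset.image_nonempty.1 hne
      · intro i hi
        exact (Finset.mem_filter.1 hi).2.2
      · intro i hi
        exact hs (Finset.mem_filter.1 hi).2.1
      · intro j
        by_contra! hj
        have : x j ∈ Metric.ball c r ∩ Set.range x := ⟨hj, j, rfl⟩
        rw [hB] at this
        exact this
    · rintro ⟨I, ⟨hne, -, c, r, hr, hs, hj⟩, rfl⟩
      refine ⟨hne.image x, ?_, _, ⟨c, r, hr, ?_, rfl⟩, ?_⟩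
      · simp
      · rintro p hp
        obtain ⟨i, hi, rfl⟩ := Finset.mem_image.1 hp
        exact hs i hi
      · rw [Set.eq_empty_iff_forall_notMem]
        rintro _ ⟨h, j, rfl⟩
        exact absurd (hj j) (not_le.2 h)
  have hinj : Set.InjOn (fun I : Finset (Fin n) => I.image x) F := by
    have key : ∀ I ∈ F, ∀ J ∈ F, I.image x = J.image x → I ⊆ J := by
      intro I hI J hJ hIJ i hi
      have hmem : x i ∈ J.image x := hIJ ▸ Finset.mem_image_of_mem x hi
      obtain ⟨j, hj, hji⟩ := Finset.mem_image.1 hmem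
      have h1 := (Finset.mem_filter.1 hI).2.2.1 i hi j hji
      have h2 := (Finset.mem_filter.1 hJ).2.2.1 j hj i hji.symm
      rwa [le_antisymm h1 h2]
    intro I hI J hJ hIJ
    exact (key I hI J hJ hIJ).antisymm (key J hJ I hI hIJ.symm)
  rw [delaunayComplexity, himg, hinj.ncard_image, Set.ncard_coe_finset]

/-- The quantifier over balls is uncountable. With `c` and `r` confined to compact sets, the closed
conditions project to a closed set, and countably many such sets suffice. -/
theorem measurableSet_isDelaunay {d n : ℕ} (I : Finset (Fin n)) :
    MeasurableSet {x : Fin n → EuclideanSpace ℝ (Fin d) | IsDelaunay I x} := by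
  set S : ∀ K : ℕ, Set ((Fin n → EuclideanSpace ℝ (Fin d)) ×
      (Metric.closedBall (0 : EuclideanSpace ℝ (Fin d)) K × Set.Icc (1 / ((K : ℝ) + 1)) K)) :=
    fun K => {q | (∀ i ∈ I, dist (q.1 i) q.2.1 = q.2.2) ∧ ∀ j, (q.2.2 : ℝ) ≤ dist (q.1 j) q.2.1}
    with hS
  have heq : {x : Fin n → EuclideanSpace ℝ (Fin d) | IsDelaunay I x} =
      ⋃ K, Prod.fst '' S K := by
    ext x
    simp only [Set.mem_ofPred_eq, Set.mem_iUnion, Set.mem_image]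
    constructor
    · rintro ⟨c, r, hr, hI, hj⟩
      obtain ⟨K₁, h1⟩ := exists_nat_ge (max ‖c‖ r)
      obtain ⟨K₂, h2⟩ := exists_nat_one_div_lt hr
      have h3 : (K₁ : ℝ) ≤ (max K₁ K₂ : ℕ) := by exact_mod_cast le_max_left _ _
      have h4 : (1 : ℝ) / ((max K₁ K₂ : ℕ) + 1) ≤ 1 / (K₂ + 1) := by
        gcongr; exact le_max_right _ _
      refine ⟨max K₁ K₂, ⟨x, ⟨c, ?_⟩, ⟨r, ?_, ?_⟩⟩, ⟨hI, hj⟩, rfl⟩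
      · simpa using (le_max_left _ _).trans (h1.trans h3)
      · exact h4.trans h2.le
      · exact (le_max_right _ _).trans (h1.trans h3)
    · rintro ⟨K, ⟨y, c, r⟩, ⟨hI, hj⟩, rfl⟩
      exact ⟨c, r, lt_of_lt_of_le (by positivity) r.2.1, hI, hj⟩
  rw [heq]
  refine MeasurableSet.iUnion fun K => IsClosed.measurableSet ?_
  have : CompactSpace (Metric.closedBall (0 : EuclideanSpace ℝ (Fin d)) K) :=
    isCompact_iff_compactSpace.1 (isCompact_closedBall _ _)
  refine isClosedMap_fst_of_compactSpace _ ?_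
  simp only [hS, Set.ofPred_and, Set.ofPred_forall]
  refine IsClosed.inter (isClosed_biInter fun i _ => isClosed_eq ?_ ?_)
    (isClosed_iInter fun j => isClosed_le ?_ ?_) <;> fun_prop

theorem measurableSet_isMinimalRep {d n : ℕ} (I : Finset (Fin n)) :
    MeasurableSet {x : Fin n → EuclideanSpace ℝ (Fin d) | IsMinimalRep I x} := by
  simp only [IsMinimalRep, Set.ofPred_forall]
  refine Finset.measurableSet_biInter _ fun i _ => MeasurableSet.iInter fun j => ?_
  have : {x : Fin n → EuclideanSpace ℝ (Fin d) | x j = x i → i ≤ j} =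
      {x | x j = x i}ᶜ ∪ {_x | i ≤ j} := by
    ext x; simp [imp_iff_not_or]
  rw [this]
  exact (measurableSet_eq_fun (by fun_prop) (by fun_prop)).compl.union (MeasurableSet.const _)

theorem measurable_delaunayComplexity (d n : ℕ) :
    Measurable fun x : Fin n → EuclideanSpace ℝ (Fin d) => delaunayComplexity (Set.range x) := by
  classical
  simp only [delaunayComplexity_eq_card, Finset.card_filter]
  refine Finset.measurable_sum _ fun I _ => Measurable.ite ?_ measurable_const measurable_const
  exact (MeasurableSet.const _).inter
    ((measurableSet_isMinimalRep I).inter (measurableSet_isDelaunay I))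

/-! ### General position: no `d + 2` cospherical points. -/

/-- The lift of `ℝ^d` to the paraboloid, in homogeneous coordinates. -/
noncomputable def paraboloidLift {d : ℕ} (x : EuclideanSpace ℝ (Fin d)) :
    EuclideanSpace ℝ (Fin d) × ℝ × ℝ := (x, ‖x‖ ^ 2, 1)

theorem continuous_paraboloidLift (d : ℕ) : Continuous (paraboloidLift (d := d)) := by
  unfold paraboloidLift; fun_prop

theorem finrank_paraboloidLift (d : ℕ) :
    Module.finrank ℝ (EuclideanSpace ℝ (Fin d) × ℝ × ℝ) = d + 2 := by
  simp

/-- The zero set is empty or a hyperplane if the quadratic coefficient `A` vanishes; otherwise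
completing the square puts it in a sphere. -/
theorem volume_paraboloidLift_eq_zero {d : ℕ} (hd : 1 ≤ d)
    {l : Module.Dual ℝ (EuclideanSpace ℝ (Fin d) × ℝ × ℝ)} (hl : l ≠ 0) :
    volume {x : EuclideanSpace ℝ (Fin d) | l (paraboloidLift x) = 0} = 0 := by
  have : Nonempty (Fin d) := ⟨⟨0, hd⟩⟩
  set f : Module.Dual ℝ (EuclideanSpace ℝ (Fin d)) := l ∘ₗ LinearMap.inl ℝ _ _ with hf
  set A : ℝ := l (0, 1, 0) with hA
  set B : ℝ := l (0, 0, 1) with hB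
  have hlx : ∀ (x : EuclideanSpace ℝ (Fin d)) (s t : ℝ), l (x, s, t) = f x + s * A + t * B := by
    intro x s t
    have : (x, s, t) = ((x, 0, 0) : EuclideanSpace ℝ (Fin d) × ℝ × ℝ) + s • (0, 1, 0) +
        t • (0, 0, 1) := by simp
    rw [this, map_add, map_add, map_smul, map_smul]
    simp only [hf, hA, hB, smul_eq_mul]
    rfl
  have hset : {x : EuclideanSpace ℝ (Fin d) | l (paraboloidLift x) = 0} =
      {x | f x + ‖x‖ ^ 2 * A + B = 0} := by
    ext x; simp [paraboloidLift, hlx]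
  rw [hset]
  by_cases hA0 : A = 0
  · by_cases hf0 : f = 0
    · have hB0 : B ≠ 0 := by
        intro hB0
        apply hl
        ext x <;> simp [hlx, hA0, hf0, hB0]
      simp [hA0, hf0, hB0]
    · obtain ⟨y, hy⟩ : ∃ y, f y ≠ 0 := by
        by_contra! h
        exact hf0 (LinearMap.ext h)
      let s : AffineSubspace ℝ (EuclideanSpace ℝ (Fin d)) :=
        (AffineSubspace.mk' (-B) (⊥ : Submodule ℝ ℝ)).comap f.toAffineMap
      have hs : ∀ x, x ∈ s ↔ f x + B = 0 := by
        intro x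
        simp [s, AffineSubspace.mem_mk']
      have hs' : {x : EuclideanSpace ℝ (Fin d) | f x + ‖x‖ ^ 2 * A + B = 0} = s := by
        ext x
        simp [hs, hA0]
      rw [hs']
      refine Measure.addHaar_affineSubspace volume s fun htop => ?_
      have h0 : (0 : EuclideanSpace ℝ (Fin d)) ∈ s := htop ▸ AffineSubspace.mem_top _ _ _
      have h1 : y ∈ s := htop ▸ AffineSubspace.mem_top _ _ _
      rw [hs, map_zero, zero_add] at h0
      rw [hs, h0, add_zero] at h1
      exact hy h1
  · set u : EuclideanSpace ℝ (Fin d) :=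
      (InnerProductSpace.toDual ℝ _).symm f.toContinuousLinearMap with hu
    have hfu : ∀ x, f x = inner ℝ x u := by
      intro x
      rw [real_inner_comm, hu, InnerProductSpace.toDual_symm_apply]
      rfl
    refine measure_mono_null ?_ (Measure.addHaar_sphere volume (-(1 / (2 * A)) • u)
      √(‖(1 / (2 * A)) • u‖ ^ 2 - B / A))
    intro x hx
    simp only [Set.mem_ofPred_eq, hfu] at hx
    rw [mem_sphere_iff_norm, neg_smul, sub_neg_eq_add, eq_comm]
    rw [eq_comm, ← Real.sqrt_sq (norm_nonneg (x + (1 / (2 * A)) • u)), norm_add_sq_real,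
      real_inner_smul_right]
    congr 1
    field_simp
    linarith

/-- The equation of the sphere is a nonzero linear functional that kills all the lifts, so they
cannot span. -/
theorem not_linearIndependent_of_cospherical {d : ℕ} {ι : Type*} [Fintype ι]
    (hι : d + 2 ≤ Fintype.card ι) {x : ι → EuclideanSpace ℝ (Fin d)}
    {c : EuclideanSpace ℝ (Fin d)} {r : ℝ} (h : ∀ i, dist (x i) c = r) :
    ¬ LinearIndependent ℝ fun i => paraboloidLift (x i) := by
  intro hli
  have hcard := hli.fintype_card_le_finrank
  rw [finrank_paraboloidLift] at hcard
  have hspan := hli.span_eq_top_of_card_eq_finrank' (by rw [finrank_paraboloidLift]; omega)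
  let l : (EuclideanSpace ℝ (Fin d) × ℝ × ℝ) →ₗ[ℝ] ℝ :=
    LinearMap.coprod (-(2 : ℝ) • (innerSL ℝ c).toLinearMap)
      (LinearMap.coprod LinearMap.id ((‖c‖ ^ 2 - r ^ 2) • LinearMap.id))
  have hl : l = 0 := by
    refine LinearMap.ext_on_range hspan fun i => ?_
    have h1 := h i
    have h2 : ‖x i - c‖ ^ 2 = r ^ 2 := by rw [← dist_eq_norm, h1]
    rw [norm_sub_sq_real, real_inner_comm] at h2
    simp [l, paraboloidLift]
    linarith
  have := LinearMap.congr_fun hl (0, 1, 0)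
  simp [l] at this

/-- Points are added one at a time. Fewer than `d + 2` lifts lie in the kernel of some nonzero
functional, and by Fubini the new independent point almost surely avoids its null zero set. -/
theorem ae_linearIndependent {d n : ℕ} (hd : 1 ≤ d) {Ω : Type*} [MeasurableSpace Ω] {μ : Measure Ω}
    [IsProbabilityMeasure μ] {X : Fin n → Ω → EuclideanSpace ℝ (Fin d)}
    (hX : ∀ i, Measurable (X i)) (hind : iIndepFun X μ)
    (hac : ∀ i, μ.map (X i) ≪ volume) (I : Finset (Fin n)) (hI : I.card ≤ d + 2) :
    ∀ᵐ ω ∂μ, LinearIndependent ℝ fun i : I => paraboloidLift (X i ω) := by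
  induction I using Finset.induction_on with
  | empty => exact Filter.Eventually.of_forall fun ω => linearIndependent_empty_type
  | insert k I hk ih =>
    rw [Finset.card_insert_of_notMem hk] at hI
    have ih := ih (by omega)
    set V : Ω → (I → EuclideanSpace ℝ (Fin d)) := fun ω i => X i ω with hV
    have hVm : Measurable V := measurable_pi_lambda _ fun i => hX i
    have hindep : IndepFun V (X k) μ := by
      have := hind.indepFun_finset I {k} (by simpa using hk) hX
      exact this.comp (φ := id) (ψ := fun y : ({k} : Finset (Fin n)) → _ =>
        y ⟨k, Finset.mem_singleton_self k⟩) measurable_id (measurable_pi_apply _)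
    set good : Set ((I → EuclideanSpace ℝ (Fin d)) × EuclideanSpace ℝ (Fin d)) :=
      {q | LinearIndependent ℝ fun o : Option I =>
        paraboloidLift (Option.casesOn' o q.2 q.1)} with hgood
    set LI : Set (I → EuclideanSpace ℝ (Fin d)) :=
      {z | LinearIndependent ℝ fun i => paraboloidLift (z i)} with hLI
    have hgood_open : IsOpen good := by
      refine (isOpen_setOfPred_linearIndependent (𝕜 := ℝ)
        (E := EuclideanSpace ℝ (Fin d) × ℝ × ℝ) (ι := Option I)).preimage
        (f := fun q : (I → EuclideanSpace ℝ (Fin d)) × EuclideanSpace ℝ (Fin d) =>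
          fun o : Option I => paraboloidLift (Option.casesOn' o q.2 q.1)) ?_
      refine continuous_pi fun o => (continuous_paraboloidLift d).comp ?_
      cases o with
      | none => exact continuous_snd
      | some i => exact (continuous_apply i).comp continuous_fst
    have hLI_open : IsOpen LI := by
      refine (isOpen_setOfPred_linearIndependent (𝕜 := ℝ)
        (E := EuclideanSpace ℝ (Fin d) × ℝ × ℝ) (ι := I)).preimage
        (f := fun z : I → EuclideanSpace ℝ (Fin d) => fun i => paraboloidLift (z i)) ?_
      exact continuous_pi fun i => (continuous_paraboloidLift d).comp (continuous_apply i)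
    have hbad : MeasurableSet ((Prod.fst ⁻¹' LI) ∩ goodᶜ) :=
      (measurable_fst hLI_open.measurableSet).inter hgood_open.measurableSet.compl
    have hnull : (μ.map V).prod (μ.map (X k)) ((Prod.fst ⁻¹' LI) ∩ goodᶜ) = 0 := by
      rw [Measure.measure_prod_null hbad]
      refine Filter.Eventually.of_forall fun z => ?_
      refine hac k ?_
      by_cases hz : z ∈ LI
      · have hspan : Submodule.span ℝ (Set.range fun i : I => paraboloidLift (z i)) < ⊤ := by
          refine lt_top_iff_ne_top.2 fun htop => ?_
          have h1 := finrank_range_le_card (R := ℝ) (fun i : I => paraboloidLift (z i))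
          rw [Set.finrank, htop, finrank_top, finrank_paraboloidLift, Fintype.card_coe] at h1
          omega
        obtain ⟨l, hl, hle⟩ := Submodule.exists_le_ker_of_lt_top _ hspan
        refine measure_mono_null ?_ (volume_paraboloidLift_eq_zero hd hl)
        rintro y ⟨-, hy⟩
        by_contra hly
        apply hy
        simp only [hgood, Set.mem_ofPred_eq]
        rw [linearIndependent_option]
        refine ⟨hz, fun hmem => hly ?_⟩
        exact hle hmem
      · refine measure_mono_null ?_ (measure_empty (μ := volume))
        rintro y ⟨hy, -⟩
        exact hz hy
    rw [← (indepFun_iff_map_prod_eq_prod_map_map hVm.aemeasurable (hX k).aemeasurable).1 hindep,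
      Measure.map_apply (hVm.prodMk (hX k)) hbad] at hnull
    filter_upwards [ih, measure_eq_zero_iff_ae_notMem.1 hnull] with ω h1 h2
    have h3 : (V ω, X k ω) ∈ good := by
      by_contra h3
      exact h2 ⟨h1, h3⟩
    have h4 : LinearIndependent ℝ fun o : Option I =>
        paraboloidLift (Option.casesOn' o (X k ω) (V ω)) := h3
    have h5 := h4.comp (Finset.subtypeInsertEquivOption hk) (Equiv.injective _)
    convert h5 using 1
    funext ⟨i, hi⟩
    by_cases hik : i = k
    · subst hik
      simp [Finset.subtypeInsertEquivOption]
    · simp [Finset.subtypeInsertEquivOption, hik, hV]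

theorem ae_card_le_of_cospherical {d n : ℕ} (hd : 1 ≤ d) {Ω : Type*} [MeasurableSpace Ω]
    {μ : Measure Ω} [IsProbabilityMeasure μ] {X : Fin n → Ω → EuclideanSpace ℝ (Fin d)}
    (hX : ∀ i, Measurable (X i)) (hind : iIndepFun X μ)
    (hac : ∀ i, μ.map (X i) ≪ volume) :
    ∀ᵐ ω ∂μ, ∀ (I : Finset (Fin n)) (c : EuclideanSpace ℝ (Fin d)) (r : ℝ),
      (∀ i ∈ I, dist (X i ω) c = r) → I.card ≤ d + 1 := by
  have h : ∀ᵐ ω ∂μ, ∀ I : Finset (Fin n), I.card = d + 2 →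
      LinearIndependent ℝ fun i : I => paraboloidLift (X i ω) := by
    rw [ae_all_iff]
    intro I
    by_cases hI : I.card = d + 2
    · filter_upwards [ae_linearIndependent hd hX hind hac I hI.le] with ω h _ using h
    · exact Filter.Eventually.of_forall fun ω h => absurd h hI
  filter_upwards [h] with ω hω I c r hs
  by_contra! hcard
  obtain ⟨I', hI', hc⟩ := Finset.exists_subset_card_eq (show d + 2 ≤ I.card by omega)
  exact not_linearIndependent_of_cospherical (x := fun i : I' => X i ω)
    (by rw [Fintype.card_coe, hc]) (fun i => hs i (hI' i.2)) (hω I' hc)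

/-! ### Expected number of simplices. -/

theorem IsDelaunay.exists_boxes {d n : ℕ} (hd : 1 ≤ d) {I : Finset (Fin n)} (hI : 2 ≤ I.card)
    {x : Fin n → EuclideanSpace ℝ (Fin d)} (hx : ∀ i, x i ∈ unitCube d) (hmin : IsMinimalRep I x)
    (hdel : IsDelaunay I x) :
    ∃ J : Finset (Fin d), J ≠ Finset.univ ∧ ∃ (α : J → ℕ) (a : ℕ),
      ∃ m ∈ cells (d + 3) J (scales J α a), (∀ i ∈ I, x i ∈ largeBox (d + 3) (scales J α a) m) ∧
        ∀ i, x i ∉ smallBox (d + 3) (scales J α a) m := by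
  obtain ⟨c, r, hr, hs, hj⟩ := hdel
  obtain ⟨i, hi, j, hj', hij⟩ := Finset.one_lt_card.1 hI
  obtain ⟨J, hJ, α, a, m, hm, hL, hS⟩ := _root_.exists_boxes hd (σ := x '' I) (c := c) (r := r)
    (by rintro _ ⟨i, -, rfl⟩; exact hx i)
    ⟨x i, ⟨i, hi, rfl⟩, x j, ⟨j, hj', rfl⟩, fun h => hij (hmin.injOn hi hj' h)⟩ hr
    (by rintro _ ⟨i, hi, rfl⟩; exact hs i hi)
  refine ⟨J, hJ, α, a, m, hm, fun i hi => hL ⟨i, hi, rfl⟩, fun i hi => ?_⟩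
  exact absurd (hj i) (not_le.2 (hS ⟨hi, hx i⟩))

/-- A union bound over all box pairs. The factor `n ^ I.card` anticipates the number of index sets
of that size. -/
theorem exists_measure_isDelaunay_le (d : ℕ) (hd : 1 ≤ d) :
    ∃ C : ℝ, 0 ≤ C ∧ ∀ (n : ℕ) (Ω : Type*) [MeasurableSpace Ω] (μ : Measure Ω)
      [IsProbabilityMeasure μ] (X : Fin n → Ω → EuclideanSpace ℝ (Fin d)),
      (∀ i, Measurable (X i)) → iIndepFun X μ →
      (∀ i, pdf.IsUniform (X i) (unitCube d) μ volume) →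
      (∀ᵐ ω ∂μ, ∀ i, X i ω ∈ unitCube d) →
      ∀ I : Finset (Fin n), 2 ≤ I.card → I.card ≤ d + 1 →
        (n : ENNReal) ^ I.card *
          μ {ω | IsMinimalRep I (fun i => X i ω) ∧ IsDelaunay I (fun i => X i ω)} ≤
          ENNReal.ofReal (C * n) := by
  obtain ⟨K, hK, hbound⟩ := exists_binomial_bound (d + 1) (c := 1 / 2 ^ ((d + 3) * d))
    (L := 4 ^ d) (by positivity)
    (by rw [div_le_one (by positivity)]; exact one_le_pow₀ (by norm_num))
    (one_le_pow₀ (by norm_num))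
  refine ⟨2 ^ d * (K * (2 ^ d * 2 ^ ((d + 3) * d) * 2 ^ d)), by positivity, ?_⟩
  intro n Ω _ μ _ X hX hind hu hcube I hI2 hId
  set S : Finset (Finset (Fin d)) := Finset.univ.erase Finset.univ with hS
  set E : (J : Finset (Fin d)) → (J → ℕ) → ℕ → (Fin d → ℕ) → Set Ω := fun J α a m =>
    {ω | (∀ i ∈ I, X i ω ∈ largeBox (d + 3) (scales J α a) m) ∧
      ∀ i ∉ I, X i ω ∉ smallBox (d + 3) (scales J α a) m} with hE
  have hcover : μ {ω | IsMinimalRep I (fun i => X i ω) ∧ IsDelaunay I (fun i => X i ω)} ≤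
      μ (⋃ J ∈ S, ⋃ α : J → ℕ, ⋃ a : ℕ, ⋃ m ∈ cells (d + 3) J (scales J α a), E J α a m) := by
    refine measure_mono_ae ?_
    filter_upwards [hcube] with ω hω h
    obtain ⟨J, hJ, α, a, m, hm, hL, hS'⟩ := IsDelaunay.exists_boxes hd hI2 hω h.1 h.2
    change ω ∈ ⋃ J ∈ S, ⋃ α : J → ℕ, ⋃ a : ℕ, ⋃ m ∈ cells (d + 3) J (scales J α a), E J α a m
    exact Set.mem_iUnion₂.2 ⟨J, by simpa [hS] using hJ, Set.mem_iUnion.2 ⟨α, Set.mem_iUnion.2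
      ⟨a, Set.mem_iUnion₂.2 ⟨m, hm, hL, fun i _ => hS' i⟩⟩⟩⟩
  have hterm : ∀ (J : Finset (Fin d)) (α : J → ℕ) (a : ℕ), ∀ m ∈ cells (d + 3) J (scales J α a),
      (n : ENNReal) ^ I.card * μ (E J α a m) ≤
      ENNReal.ofReal K * ENNReal.ofReal (profile (n * ∏ i, 1 / 2 ^ scales J α a i)) := by
    intro J α a m hm
    have hv0 : (0 : ℝ) ≤ ∏ i, 1 / 2 ^ scales J α a i := by positivity
    have hv1 : ∏ i, (1 : ℝ) / 2 ^ scales J α a i ≤ 1 :=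
      Finset.prod_le_one (fun _ _ => by positivity) fun i _ => by
        rw [div_le_one (by positivity)]; exact one_le_pow₀ (by norm_num)
    have hIn : I.card ≤ n := by simpa using Finset.card_le_univ I
    calc (n : ENNReal) ^ I.card * μ (E J α a m)
        ≤ (n : ENNReal) ^ I.card * _ := mul_le_mul_right (measure_boxes_le hX hind hu I hm) _
      _ = ENNReal.ofReal ((n : ℝ) ^ I.card * _) := by
          rw [ENNReal.ofReal_mul (p := (n : ℝ) ^ I.card) (by positivity),
            ENNReal.ofReal_pow (p := (n : ℝ)) (by positivity), ENNReal.ofReal_natCast]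
      _ ≤ ENNReal.ofReal (K * profile (n * ∏ i, 1 / 2 ^ scales J α a i)) :=
          ENNReal.ofReal_le_ofReal (hbound n I.card _ hI2 hId hIn hv0 hv1)
      _ = _ := ENNReal.ofReal_mul hK
  have hJ : ∀ J ∈ S, (n : ENNReal) ^ I.card *
      ∑' (α : J → ℕ) (a : ℕ), ∑ m ∈ cells (d + 3) J (scales J α a), μ (E J α a m) ≤
      ENNReal.ofReal (K * (2 ^ d * 2 ^ ((d + 3) * d) * 2 ^ d * n)) := by
    intro J hJS
    rw [ENNReal.ofReal_mul hK]
    refine le_trans ?_ (mul_le_mul_right (tsum_profile_le (b := d + 3) (J := J)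
      (by simpa [hS] using hJS) n) _)
    simp only [← ENNReal.tsum_mul_left, Finset.mul_sum]
    exact ENNReal.tsum_le_tsum fun α => ENNReal.tsum_le_tsum fun a =>
      Finset.sum_le_sum fun m hm => hterm J α a m hm
  calc _ ≤ (n : ENNReal) ^ I.card * ∑ J ∈ S, ∑' (α : J → ℕ) (a : ℕ),
          ∑ m ∈ cells (d + 3) J (scales J α a), μ (E J α a m) := by
        refine mul_le_mul_right (hcover.trans ?_) _
        refine (measure_biUnion_finset_le _ _).trans (Finset.sum_le_sum fun J _ => ?_)
        refine (measure_iUnion_le _).trans (ENNReal.tsum_le_tsum fun α => ?_)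
        refine (measure_iUnion_le _).trans (ENNReal.tsum_le_tsum fun a => ?_)
        exact measure_biUnion_finset_le _ _
    _ ≤ ∑ _J ∈ S, ENNReal.ofReal (K * (2 ^ d * 2 ^ ((d + 3) * d) * 2 ^ d * n)) := by
        rw [Finset.mul_sum]
        exact Finset.sum_le_sum hJ
    _ ≤ ENNReal.ofReal (2 ^ d * (K * (2 ^ d * 2 ^ ((d + 3) * d) * 2 ^ d)) * n) := by
        rw [Finset.sum_const, nsmul_eq_mul, ← ENNReal.ofReal_natCast,
          ← ENNReal.ofReal_mul (by positivity)]
        apply ENNReal.ofReal_le_ofReal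
        have hcard : (S.card : ℝ) ≤ 2 ^ d := by
          have := Finset.card_le_univ S
          rw [Fintype.card_finset, Fintype.card_fin] at this
          exact_mod_cast this
        calc (S.card : ℝ) * (K * (2 ^ d * 2 ^ ((d + 3) * d) * 2 ^ d * n))
            ≤ 2 ^ d * (K * (2 ^ d * 2 ^ ((d + 3) * d) * 2 ^ d * n)) := by gcongr
          _ = _ := by ring

open Classical in
theorem delaunayComplexity_le {d n : ℕ} {x : Fin n → EuclideanSpace ℝ (Fin d)}
    (hx : ∀ (I : Finset (Fin n)) (c : EuclideanSpace ℝ (Fin d)) (r : ℝ),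
      (∀ i ∈ I, dist (x i) c = r) → I.card ≤ d + 1) :
    delaunayComplexity (Set.range x) ≤ n + ∑ k ∈ Finset.Icc 2 (d + 1),
      ∑ I ∈ Finset.powersetCard k Finset.univ,
        if IsMinimalRep I x ∧ IsDelaunay I x then 1 else 0 := by
  rw [delaunayComplexity_eq_card]
  simp only [← Finset.card_filter]
  have hsub : (Finset.univ.filter fun I : Finset (Fin n) =>
      I.Nonempty ∧ IsMinimalRep I x ∧ IsDelaunay I x) ⊆ Finset.powersetCard 1 Finset.univ ∪
      (Finset.Icc 2 (d + 1)).biUnion fun k => (Finset.powersetCard k Finset.univ).filter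
        fun I => IsMinimalRep I x ∧ IsDelaunay I x := by
    intro I hI
    obtain ⟨-, hne, hmin, hdel⟩ := Finset.mem_filter.1 hI
    have hcard : I.card ≤ d + 1 := by
      obtain ⟨c, r, -, hs, -⟩ := hdel
      exact hx I c r hs
    have h1 := hne.card_pos
    rw [Finset.mem_union, Finset.mem_powersetCard, Finset.mem_biUnion]
    by_cases h : I.card = 1
    · exact Or.inl ⟨Finset.subset_univ _, h⟩
    · exact Or.inr ⟨I.card, Finset.mem_Icc.2 ⟨by omega, hcard⟩, Finset.mem_filter.2
        ⟨Finset.mem_powersetCard.2 ⟨Finset.subset_univ _, rfl⟩, hmin, hdel⟩⟩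
  refine (Finset.card_le_card hsub).trans ((Finset.card_union_le _ _).trans ?_)
  refine add_le_add ?_ Finset.card_biUnion_le
  simp

theorem mainTheorem2 (d : ℕ) (hd : 1 ≤ d) :
    ∃ C : ℝ, ∀ (n : ℕ) (Ω : Type*) [MeasurableSpace Ω] (μ : Measure Ω) [IsProbabilityMeasure μ]
      (X : Fin n → Ω → EuclideanSpace ℝ (Fin d)),
      (∀ i, Measurable (X i)) →
      iIndepFun X μ →
      (∀ i, pdf.IsUniform (X i) (unitCube d) μ volume) →
      Integrable (fun ω => (delaunayComplexity (Set.range fun i => X i ω) : ℝ)) μ ∧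
        ∫ ω, (delaunayComplexity (Set.range fun i => X i ω) : ℝ) ∂μ ≤ C * n := by
  classical
  obtain ⟨C, hC, hdel⟩ := exists_measure_isDelaunay_le d hd
  -- One `n` for the vertices and `C * n` for each of the `d` sizes from 2 to `d + 1`.
  refine ⟨1 + d * C, ?_⟩
  intro n Ω _ μ _ X hX hind hu
  have hXm : Measurable fun ω => fun i => X i ω := measurable_pi_lambda _ hX
  have hmeas : Measurable fun ω => delaunayComplexity (Set.range fun i => X i ω) :=
    (measurable_delaunayComplexity d n).comp hXm
  have hmeasR : Measurable fun ω => (delaunayComplexity (Set.range fun i => X i ω) : ℝ) :=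
    measurable_from_nat.comp hmeas
  have hint : Integrable (fun ω => (delaunayComplexity (Set.range fun i => X i ω) : ℝ)) μ := by
    refine Integrable.of_bound hmeasR.aestronglyMeasurable (2 ^ n)
      (Filter.Eventually.of_forall fun ω => ?_)
    rw [Real.norm_natCast, delaunayComplexity_eq_card]
    have := Finset.card_le_univ (Finset.univ.filter fun I : Finset (Fin n) =>
      I.Nonempty ∧ IsMinimalRep I (fun i => X i ω) ∧ IsDelaunay I fun i => X i ω)
    rw [Fintype.card_finset, Fintype.card_fin] at this
    exact_mod_cast this
  refine ⟨hint, ?_⟩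
  have hcube : ∀ᵐ ω ∂μ, ∀ i, X i ω ∈ unitCube d := by
    rw [ae_all_iff]
    intro i
    have hQ : MeasurableSet (unitCube d) := measurableSet_box _ _
    have h := (hu i).measure_preimage (by simp [volume_unitCube]) (by simp [volume_unitCube])
      hQ.compl
    rw [Set.inter_compl_self, measure_empty, ENNReal.zero_div] at h
    filter_upwards [measure_eq_zero_iff_ae_notMem.1 h] with ω hω
    simpa using hω
  have hgen := ae_card_le_of_cospherical hd hX hind fun i => (hu i).absolutelyContinuous
  set A : Finset (Fin n) → Set Ω := fun I =>
    {ω | IsMinimalRep I (fun i => X i ω) ∧ IsDelaunay I (fun i => X i ω)} with hA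
  have hAm : ∀ I, MeasurableSet (A I) := fun I =>
    hXm ((measurableSet_isMinimalRep I).inter (measurableSet_isDelaunay I))
  have hle : ∀ᵐ ω ∂μ, (delaunayComplexity (Set.range fun i => X i ω) : ENNReal) ≤
      n + ∑ k ∈ Finset.Icc 2 (d + 1), ∑ I ∈ Finset.powersetCard k Finset.univ,
        (A I).indicator 1 ω := by
    filter_upwards [hgen] with ω hω
    refine (Nat.cast_le.2 (delaunayComplexity_le hω)).trans (le_of_eq ?_)
    simp [Set.indicator_apply, hA]
  have hsum : ∀ k ∈ Finset.Icc 2 (d + 1), ∑ I ∈ Finset.powersetCard k Finset.univ, μ (A I) ≤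
      ENNReal.ofReal (C * n) := by
    intro k hk
    rw [Finset.mem_Icc] at hk
    rcases Nat.eq_zero_or_pos n with rfl | hn
    · rw [Finset.powersetCard_eq_empty.2 (by simpa using by omega)]
      simp
    have hnk0 : (n : ENNReal) ^ k ≠ 0 := by simp [hn.ne']
    have hnkt : (n : ENNReal) ^ k ≠ ⊤ := by simp
    calc ∑ I ∈ Finset.powersetCard k Finset.univ, μ (A I)
        ≤ ∑ _I ∈ Finset.powersetCard k (Finset.univ : Finset (Fin n)),
            ENNReal.ofReal (C * n) / (n : ENNReal) ^ k := by
          refine Finset.sum_le_sum fun I hI => ?_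
          have hIk := (Finset.mem_powersetCard.1 hI).2
          rw [ENNReal.le_div_iff_mul_le (Or.inl hnk0) (Or.inl hnkt), mul_comm, ← hIk]
          exact hdel n Ω μ X hX hind hu hcube I (by omega) (by omega)
      _ = (n.choose k : ENNReal) * (ENNReal.ofReal (C * n) / (n : ENNReal) ^ k) := by
          rw [Finset.sum_const, Finset.card_powersetCard, Finset.card_univ, Fintype.card_fin,
            nsmul_eq_mul]
      _ ≤ (n : ENNReal) ^ k * (ENNReal.ofReal (C * n) / (n : ENNReal) ^ k) := by
          refine mul_le_mul_left ?_ _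
          exact_mod_cast Nat.choose_le_pow n k
      _ ≤ ENNReal.ofReal (C * n) := ENNReal.mul_div_le
  rw [← ENNReal.ofReal_le_ofReal_iff (by positivity),
    ofReal_integral_eq_lintegral_ofReal hint (Filter.Eventually.of_forall fun ω => by positivity)]
  simp only [ENNReal.ofReal_natCast]
  calc ∫⁻ ω, (delaunayComplexity (Set.range fun i => X i ω) : ENNReal) ∂μ
      ≤ ∫⁻ ω, (n + ∑ k ∈ Finset.Icc 2 (d + 1), ∑ I ∈ Finset.powersetCard k Finset.univ,
        (A I).indicator 1 ω) ∂μ := lintegral_mono_ae hle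
    _ = n + ∑ k ∈ Finset.Icc 2 (d + 1), ∑ I ∈ Finset.powersetCard k Finset.univ, μ (A I) := by
        rw [lintegral_add_left measurable_const, lintegral_const, measure_univ, mul_one,
          lintegral_finsetSum _ fun k _ => Finset.measurable_fun_sum _ fun I _ =>
            measurable_one.indicator (hAm I)]
        congr 1
        refine Finset.sum_congr rfl fun k _ => ?_
        rw [lintegral_finsetSum _ fun I _ => measurable_one.indicator (hAm I)]
        exact Finset.sum_congr rfl fun I _ => lintegral_indicator_one (hAm I)
    _ ≤ n + ∑ _k ∈ Finset.Icc 2 (d + 1), ENNReal.ofReal (C * n) := by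
        gcongr with k hk
        exact hsum k hk
    _ = ENNReal.ofReal ((1 + d * C) * n) := by
        rw [Finset.sum_const, Nat.card_Icc, nsmul_eq_mul, ← ENNReal.ofReal_natCast,
          ← ENNReal.ofReal_natCast, ← ENNReal.ofReal_mul (by positivity),
          ← ENNReal.ofReal_add (by positivity) (by positivity)]
        congr 1
        have : ((d + 1 + 1 - 2 : ℕ) : ℝ) = d := by
          rw [show d + 1 + 1 - 2 = d by omega]
        rw [this]; ring
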